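/- Let $f(x)=e^{-1/(1-x^2)}$ for $x\in(-1,1)$ and $f(x)=0$ otherwise, and let $F(k)=\int_{-\infty}^{\infty}f(x)e^{ikx}\,dx$ for real $k$. Then, with $\sqrt{\cdot}$ denoting the principal branch of the complex square root (so that $\sqrt{2i}=1+i$), as $k\to+\infty$ through the reals, $$F(k)=2\,\mathrm{Re}\left[\sqrt{\frac{-i\pi}{\sqrt{2i}\,k^{3/2}}}\;e^{ik-\frac14-\sqrt{2ik}}\right]+o\!\left(k^{-3/4}e^{-\sqrt{k}}\right).$$ Consequently $F(k)=O\!\left(k^{-3/4}e^{-\sqrt{k}}\right)$, and this rate is sharp with explicit leading coefficient: $$\limsup_{k\to+\infty}\frac{|F(k)|}{k^{-3/4}e^{-\sqrt{k}}}=2\sqrt{\frac{\pi}{\sqrt2}}\;e^{-1/4}.$$ -/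

import Mathlib

open Filter Asymptotics MeasureTheory

noncomputable section

/-- The bump function `x ↦ exp (-1 / (1 - x ^ 2))` on `(-1, 1)`, extended by zero. -/
def bump (x : ℝ) : ℝ :=
  (Set.Ioo (-1 : ℝ) 1).indicator (fun y => Real.exp (-1 / (1 - y ^ 2))) x

/-- The Fourier transform `F k = ∫ f x * exp (i k x) dx` of the bump function. -/
def bumpFourier (k : ℝ) : ℂ :=
  ∫ x : ℝ, (bump x : ℂ) * Complex.exp (Complex.I * k * x)

/-- The complex saddle-point contribution
`√(-iπ / (√(2i) k ^ (3/2))) * exp (ik - 1/4 - √(2ik))`,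
with principal square roots. -/
def saddleTerm (k : ℝ) : ℂ :=
  Complex.sqrt (-Complex.I * (Real.pi : ℂ) /
      (Complex.sqrt (2 * Complex.I) * ((k ^ (3 / 2 : ℝ) : ℝ) : ℂ))) *
    Complex.exp (Complex.I * k - 1 / 4 - Complex.sqrt (2 * Complex.I * k))

end

/-! This is the method of steepest descent, with a contour on which the phase is exactly explicit.
By symmetry `F k` is twice the real part of the kernel's integral over `[0, 1]`. Replace that path
by `0 → i → 1`: on the imaginary axis the kernel is real while `dz = i dy`, so this leg contributes
nothing to the real part (`re_integral_bumpKernel_eq`).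

On the leg `z = 1 - (1 - i)σ`, partial fractions turn the exponent into `ik - (1 + i)(1/(4σ) + kσ)`
plus a term regular at `σ = 0`. The bracket is real, with minimum `√k` at `σ = 1/(2√k)`; this gives
the decay `e^{-√k}` and the oscillation `k - √k`. With `k = m ^ 4` and `σ` rescaled about the
minimum, the integrand tends to a Gaussian times `e^{-1/4}`, and dominated convergence applies
(`tendsto_integral_saddleIntegrand`).

The limit equals the stated term once the branches of the roots are matched (`saddleTerm_pow_four`).
Its real part is a modulus times the cosine of a phase that is continuous and tends to infinity, so
the cosine returns to `1` and the constant is attained in the limsup. -/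

/-! ### The kernel and its primitive on a disc -/

/-- The complex extension `z ↦ exp (-1 / (1 - z ^ 2)) * exp (i k z)` of the integrand. -/
noncomputable def bumpKernel (k : ℝ) (z : ℂ) : ℂ :=
  Complex.exp (-1 / (1 - z ^ 2)) * Complex.exp (Complex.I * k * z)

theorem measurable_bumpKernel (k : ℝ) : Measurable (bumpKernel k) := by
  unfold bumpKernel
  fun_prop

/-- In this half-strip `Re (1 - z²) ≥ 0`, hence `Re (-1/(1 - z²)) ≤ 0`. The endpoints `±1` are
included because division by zero makes the first factor `exp 0` there. -/
theorem norm_bumpKernel_le_one {k : ℝ} (hk : 0 ≤ k) {z : ℂ} (hre : |z.re| ≤ 1) (him : 0 ≤ z.im) :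
    ‖bumpKernel k z‖ ≤ 1 := by
  rw [bumpKernel, norm_mul, Complex.norm_exp, Complex.norm_exp]
  have h1 : (-1 / (1 - z ^ 2)).re ≤ 0 := by
    have hsq : z.re ^ 2 ≤ 1 := (sq_le_one_iff_abs_le_one _).2 hre
    have h0 : 0 ≤ (1 - z ^ 2).re := by
      simp only [Complex.sub_re, Complex.one_re, pow_two, Complex.mul_re]
      nlinarith [sq_nonneg z.im]
    rw [neg_div, Complex.neg_re, one_div, Complex.inv_re]
    exact neg_nonpos.2 (div_nonneg h0 (Complex.normSq_nonneg _))
  have h2 : (Complex.I * k * z).re ≤ 0 := by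
    simp only [Complex.mul_re, Complex.I_re, Complex.I_im, Complex.ofReal_re, Complex.ofReal_im,
      Complex.mul_im]
    nlinarith [mul_nonneg hk him]
  exact mul_le_one₀ (Real.exp_le_one_iff.2 h1) (Real.exp_pos _).le (Real.exp_le_one_iff.2 h2)

theorem differentiableAt_bumpKernel (k : ℝ) {z : ℂ} (hz : 1 - z ^ 2 ≠ 0) :
    DifferentiableAt ℂ (bumpKernel k) z := by
  unfold bumpKernel
  fun_prop (disch := assumption)

/-- The boundary circle passes through `±1`, so the open disc avoids both singularities yet contains
`0`, `i` and the segments from them to `1`, short of `1` itself. -/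
theorem mem_ball_half_I_iff {z : ℂ} :
    z ∈ Metric.ball (Complex.I / 2) (Real.sqrt (5 / 4)) ↔
      z.re ^ 2 + z.im ^ 2 - z.im < 1 := by
  rw [mem_ball_iff_norm, Complex.norm_def, Real.sqrt_lt_sqrt_iff (Complex.normSq_nonneg _),
    Complex.normSq_apply]
  simp only [Complex.sub_re, Complex.sub_im, Complex.div_ofNat_re, Complex.div_ofNat_im,
    Complex.I_re, Complex.I_im]
  constructor <;> intro h <;> nlinarith

theorem exists_primitive_bumpKernel (k : ℝ) :
    ∃ Φ : ℂ → ℂ, ∀ z : ℂ, z.re ^ 2 + z.im ^ 2 - z.im < 1 → HasDerivAt Φ (bumpKernel k z) z := by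
  have hd : DifferentiableOn ℂ (bumpKernel k)
      (Metric.ball (Complex.I / 2) (Real.sqrt (5 / 4))) := by
    intro z hz
    refine (differentiableAt_bumpKernel k fun h => ?_).differentiableWithinAt
    rw [mem_ball_half_I_iff] at hz
    have : (z - 1) * (z + 1) = 0 := by linear_combination -h
    rcases mul_eq_zero.1 this with h | h
    · rw [sub_eq_zero.1 h] at hz
      norm_num at hz
    · rw [eq_neg_of_add_eq_zero_left h] at hz
      norm_num at hz
  obtain ⟨Φ, hΦ⟩ := hd.isExactOn_ball
  exact ⟨Φ, fun z hz => hΦ z (mem_ball_half_I_iff.2 hz)⟩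

theorem intervalIntegrable_of_measurable_of_norm_le {f : ℝ → ℂ} {a b C : ℝ} (hf : Measurable f)
    (hC : ∀ x ∈ Set.uIoc a b, ‖f x‖ ≤ C) : IntervalIntegrable f volume a b :=
  (intervalIntegrable_const (c := C)).mono_fun hf.aestronglyMeasurable <| by
    filter_upwards [ae_restrict_mem measurableSet_uIoc] with x hx
    exact (hC x hx).trans (Real.le_norm_self C)

/-! ### Contour deformation -/

/-- The integrand on the segment from `1` to `i`, parametrised by `σ ↦ 1 - (1 - i) σ`. -/
noncomputable def bumpRay (k σ : ℝ) : ℂ :=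
  (1 - Complex.I) * bumpKernel k (1 - (1 - Complex.I) * σ)

theorem measurable_bumpRay (k : ℝ) : Measurable (bumpRay k) :=
  ((measurable_bumpKernel k).comp (by fun_prop)).const_mul _

theorem norm_bumpRay_le {k : ℝ} (hk : 0 ≤ k) {σ : ℝ} (h0 : 0 ≤ σ) (h1 : σ ≤ 1) :
    ‖bumpRay k σ‖ ≤ 2 := by
  have hn : ‖(1 - Complex.I : ℂ)‖ ≤ 2 := (norm_sub_le _ _).trans (by norm_num)
  have := norm_bumpKernel_le_one hk (z := 1 - (1 - Complex.I) * σ)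
    (by simp; rw [abs_le]; constructor <;> linarith) (by simpa using h0)
  rw [bumpRay, norm_mul]
  exact (mul_le_mul hn this (norm_nonneg _) (by norm_num)).trans (by norm_num)

theorem hasDerivAt_primitive_comp {Φ : ℂ → ℂ} {k : ℝ}
    (hΦ : ∀ z : ℂ, z.re ^ 2 + z.im ^ 2 - z.im < 1 → HasDerivAt Φ (bumpKernel k z) z)
    (a b : ℂ) (x : ℝ)
    (hx : (a + b * x).re ^ 2 + (a + b * x).im ^ 2 - (a + b * x).im < 1) :
    HasDerivAt (fun y : ℝ => Φ (a + b * y)) (b * bumpKernel k (a + b * x)) x := by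
  have h1 : HasDerivAt (fun y : ℝ => a + b * (y : ℂ)) b x := by
    simpa using ((Complex.ofRealCLM.hasDerivAt (x := x)).const_mul b).const_add a
  rw [mul_comm]
  exact (hΦ _ hx).comp x h1

theorem re_primitive_I_eq {Φ : ℂ → ℂ} {k : ℝ}
    (hΦ : ∀ z : ℂ, z.re ^ 2 + z.im ^ 2 - z.im < 1 → HasDerivAt Φ (bumpKernel k z) z) :
    (Φ Complex.I).re = (Φ 0).re := by
  have hd : ∀ y ∈ Set.uIcc (0 : ℝ) 1, HasDerivAt (fun y : ℝ => (Φ (0 + Complex.I * y)).re) 0 y := by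
    intro y hy
    rw [Set.uIcc_of_le zero_le_one] at hy
    have h := hasDerivAt_primitive_comp hΦ 0 Complex.I y (by simp; nlinarith [hy.1, hy.2])
    have h2 := Complex.reCLM.hasFDerivAt.comp_hasDerivAt y h
    have e : bumpKernel k (0 + Complex.I * y)
        = ((Real.exp (-1 / (1 + y ^ 2)) * Real.exp (-(k * y)) : ℝ) : ℂ) := by
      rw [bumpKernel]
      push_cast
      congr 2
      · rw [zero_add, mul_pow, Complex.I_sq]; ring
      · linear_combination (k * y : ℂ) * Complex.I_sq
    rw [e, Complex.reCLM_apply, Complex.re_mul_ofReal, Complex.I_re, zero_mul] at h2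
    exact h2
  have := intervalIntegral.integral_eq_sub_of_hasDerivAt hd intervalIntegrable_const
  simp only [intervalIntegral.integral_zero, Complex.ofReal_one, Complex.ofReal_zero, mul_one,
    mul_zero, zero_add] at this
  linarith

theorem re_integral_bumpKernel_eq {k : ℝ} (hk : 0 ≤ k) :
    (∫ x in (0 : ℝ)..1, bumpKernel k x).re = (∫ σ in (0 : ℝ)..1, bumpRay k σ).re := by
  obtain ⟨Φ, hΦ⟩ := exists_primitive_bumpKernel k
  have hm : Measurable fun x : ℝ => bumpKernel k x :=
    (measurable_bumpKernel k).comp Complex.measurable_ofReal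
  have hb : ∀ x : ℝ, 0 ≤ x → x ≤ 1 → ‖bumpKernel k x‖ ≤ 1 := fun x h0 h1 =>
    norm_bumpKernel_le_one hk (by simpa [abs_of_nonneg h0] using h1) (by simp)
  have hi1 : ∀ a b : ℝ, 0 ≤ a → a ≤ b → b ≤ 1 →
      IntervalIntegrable (fun x : ℝ => bumpKernel k x) volume a b := fun a b h0 hab h1 =>
    intervalIntegrable_of_measurable_of_norm_le hm (C := 1) fun x hx => by
      rw [Set.uIoc_of_le hab] at hx
      exact hb x (h0.trans hx.1.le) (hx.2.trans h1)
  have hi2 : ∀ a b : ℝ, 0 ≤ a → a ≤ b → b ≤ 1 →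
      IntervalIntegrable (bumpRay k) volume a b := fun a b h0 hab h1 =>
    intervalIntegrable_of_measurable_of_norm_le (measurable_bumpRay k) (C := 2) fun x hx => by
      rw [Set.uIoc_of_le hab] at hx
      exact norm_bumpRay_le hk (h0.trans hx.1.le) (hx.2.trans h1)
  -- The primitive is unavailable at `1`, so both paths are cut near it and joined by the vertical
  -- segment from `1 - ε` to `1 - ε + iε`. The two cut ends and the joining segment cost `ε`, `2ε`
  -- and `ε`.
  have key : ∀ ε : ℝ, 0 < ε → ε < 1 →
      ‖((∫ x in (0 : ℝ)..1, bumpKernel k x) - ∫ σ in (0 : ℝ)..1, bumpRay k σ)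
        - (Φ Complex.I - Φ 0)‖ ≤ 4 * ε := by
    intro ε h0 h1
    have e1 : ∫ x in (0 : ℝ)..(1 - ε), bumpKernel k x = Φ ((1 - ε : ℝ) : ℂ) - Φ 0 := by
      have := intervalIntegral.integral_eq_sub_of_hasDerivAt
        (f := fun y : ℝ => Φ (0 + 1 * y)) (f' := fun y : ℝ => 1 * bumpKernel k (0 + 1 * y))
        (a := 0) (b := 1 - ε)
        (fun x hx => by
          rw [Set.uIcc_of_le (by linarith)] at hx
          exact hasDerivAt_primitive_comp hΦ 0 1 x
            (by simp; exact abs_lt.2 ⟨by linarith [hx.1], by linarith [hx.2]⟩))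
        (by simpa using hi1 0 (1 - ε) le_rfl (by linarith) (by linarith))
      simpa using this
    have hray : (fun y : ℝ => -(1 - Complex.I) * bumpKernel k (1 + -(1 - Complex.I) * y))
        = -bumpRay k := by
      ext y
      simp only [bumpRay, neg_mul, sub_eq_add_neg, Pi.neg_apply]
    have e2 : ∫ σ in ε..1, bumpRay k σ = Φ (1 - (1 - Complex.I) * ε) - Φ Complex.I := by
      have := intervalIntegral.integral_eq_sub_of_hasDerivAt
        (f := fun y : ℝ => Φ (1 + -(1 - Complex.I) * y))
        (f' := fun y : ℝ => -(1 - Complex.I) * bumpKernel k (1 + -(1 - Complex.I) * y))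
        (a := ε) (b := 1)
        (fun x hx => by
          rw [Set.uIcc_of_le h1.le] at hx
          exact hasDerivAt_primitive_comp hΦ 1 _ x (by simp; nlinarith [hx.1, hx.2]))
        (hray ▸ (hi2 ε 1 h0.le h1.le le_rfl).neg)
      have h3 : ∫ σ in ε..1, bumpRay k σ
          = -∫ y in ε..1, -(1 - Complex.I) * bumpKernel k (1 + -(1 - Complex.I) * y) := by
        rw [hray, ← intervalIntegral.integral_neg]
        simp only [Pi.neg_apply, neg_neg]
      rw [h3, this]
      simp only [Complex.ofReal_one]
      ring_nf
    have s1 := intervalIntegral.integral_add_adjacent_intervals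
      (hi1 0 (1 - ε) le_rfl (by linarith) (by linarith))
      (hi1 (1 - ε) 1 (by linarith) (by linarith) le_rfl)
    have s2 := intervalIntegral.integral_add_adjacent_intervals
      (hi2 0 ε le_rfl h0.le h1.le) (hi2 ε 1 h0.le h1.le le_rfl)
    have b1 : ‖∫ x in (1 - ε)..1, bumpKernel k x‖ ≤ ε := by
      have := intervalIntegral.norm_integral_le_of_norm_le_const (a := 1 - ε) (b := 1) (C := 1)
        (f := fun x : ℝ => bumpKernel k x) fun x hx => by
          rw [Set.uIoc_of_le (by linarith)] at hx
          exact hb x (by linarith [hx.1]) hx.2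
      simpa [abs_of_pos h0] using this
    have b2 : ‖∫ σ in (0 : ℝ)..ε, bumpRay k σ‖ ≤ 2 * ε := by
      have := intervalIntegral.norm_integral_le_of_norm_le_const (a := 0) (b := ε) (C := 2)
        (f := bumpRay k) fun x hx => by
          rw [Set.uIoc_of_le h0.le] at hx
          exact norm_bumpRay_le hk hx.1.le (hx.2.trans h1.le)
      simpa [abs_of_pos h0] using this
    have b3 : ‖Φ (1 - (1 - Complex.I) * ε) - Φ ((1 - ε : ℝ) : ℂ)‖ ≤ ε := by
      have := Convex.norm_image_sub_le_of_norm_hasDerivWithin_le (𝕜 := ℝ)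
        (f := fun y : ℝ => Φ (((1 - ε : ℝ) : ℂ) + Complex.I * y))
        (f' := fun y : ℝ => Complex.I * bumpKernel k (((1 - ε : ℝ) : ℂ) + Complex.I * y))
        (s := Set.Icc 0 ε) (x := 0) (y := ε) (C := 1)
        (fun x hx => (hasDerivAt_primitive_comp hΦ _ _ x
          (by simp; nlinarith [hx.1, hx.2])).hasDerivWithinAt)
        (fun x hx => by
          rw [norm_mul, Complex.norm_I, one_mul]
          exact norm_bumpKernel_le_one hk
            (by simp; rw [abs_le]; constructor <;> linarith) (by simpa using hx.1))
        (convex_Icc 0 ε) ⟨le_rfl, h0.le⟩ ⟨h0.le, le_rfl⟩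
      have e : (1 - (1 - Complex.I) * ε : ℂ) = ((1 - ε : ℝ) : ℂ) + Complex.I * ε := by
        push_cast; ring
      rw [e]
      simpa [abs_of_pos h0] using this
    rw [← s1, ← s2, e1, e2]
    have e3 : ∀ A B C D E F : ℂ, A - F + B - (C + (D - E)) - (E - F) = B - C - (D - A) := by
      intros; ring
    rw [e3]
    refine (norm_sub_le _ _).trans ?_
    linarith [norm_sub_le (∫ x in (1 - ε)..1, bumpKernel k x) (∫ σ in (0 : ℝ)..ε, bumpRay k σ)]
  have hz : ((∫ x in (0 : ℝ)..1, bumpKernel k x) - ∫ σ in (0 : ℝ)..1, bumpRay k σ)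
        - (Φ Complex.I - Φ 0) = 0 := by
    rw [← norm_le_zero_iff]
    refine le_of_forall_pos_le_add fun δ hδ => ?_
    have := key (min (δ / 4) (1 / 2)) (by positivity) (by
      linarith [min_le_right (δ / 4) (1 / 2 : ℝ)])
    linarith [min_le_left (δ / 4) (1 / 2 : ℝ)]
  have hr := congrArg Complex.re hz
  simp only [Complex.sub_re, Complex.zero_re, re_primitive_I_eq hΦ] at hr
  linarith

theorem bumpFourier_eq {k : ℝ} (hk : 0 ≤ k) :
    bumpFourier k = ((2 * (∫ σ in (0 : ℝ)..1, bumpRay k σ).re : ℝ) : ℂ) := by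
  have hm : Measurable fun x : ℝ => bumpKernel k x :=
    (measurable_bumpKernel k).comp Complex.measurable_ofReal
  have hi : ∀ a b : ℝ, -1 ≤ a → a ≤ b → b ≤ 1 →
      IntervalIntegrable (fun x : ℝ => bumpKernel k x) volume a b := fun a b h0 hab h1 =>
    intervalIntegrable_of_measurable_of_norm_le hm (C := 1) fun x hx => by
      rw [Set.uIoc_of_le hab] at hx
      exact norm_bumpKernel_le_one hk
        (by simpa [abs_le] using ⟨h0.trans hx.1.le, hx.2.trans h1⟩) (by simp)
  have h1 : bumpFourier k = ∫ x in (-1 : ℝ)..1, bumpKernel k x := by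
    rw [intervalIntegral.integral_of_le (by norm_num), ← integral_Ioc_eq_integral_Ioo.symm,
      ← integral_indicator measurableSet_Ioo, bumpFourier]
    congr 1
    ext x
    by_cases hx : x ∈ Set.Ioo (-1 : ℝ) 1
    · simp [bump, hx, bumpKernel]
    · simp [bump, hx]
  have h2 : ∫ x in (-1 : ℝ)..0, bumpKernel k x
      = starRingEnd ℂ (∫ x in (0 : ℝ)..1, bumpKernel k x) := by
    have := intervalIntegral.integral_comp_neg (a := 0) (b := 1) fun x : ℝ => bumpKernel k x
    rw [neg_zero] at this
    rw [← this, intervalIntegral.integral_of_le zero_le_one,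
      intervalIntegral.integral_of_le zero_le_one, ← integral_conj]
    congr 1
    ext x
    simp only [bumpKernel, map_mul, ← Complex.exp_conj]
    simp
  rw [h1, ← intervalIntegral.integral_add_adjacent_intervals
    (hi (-1) 0 le_rfl (by norm_num) zero_le_one) (hi 0 1 (by norm_num) zero_le_one le_rfl), h2,
    add_comm, Complex.add_conj, re_integral_bumpKernel_eq hk]

/-! ### Rescaling about the saddle point -/

/-- The integrand over the steepest descent ray for `k = m ^ 4`, centred at the saddle point
`σ = 1 / (2 m ^ 2)` and rescaled by `σ = (m + v) / (2 m ^ 3)`. -/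
noncomputable def saddleIntegrand (m : ℝ) : ℝ → ℂ :=
  {v : ℝ | 0 < m + v ∧ m + v ≤ 2 * m ^ 3}.indicator fun v =>
    Complex.exp (-(1 + Complex.I) * ((v ^ 2 * m / (2 * (m + v)) : ℝ) : ℂ)) *
      Complex.exp (-1 / (2 * (2 - (1 - Complex.I) * (((m + v) / (2 * m ^ 3) : ℝ) : ℂ))))

theorem bumpRay_saddle_scaling {m v : ℝ} (hm : 0 < m) (hv : 0 < m + v) :
    bumpRay (m ^ 4) ((m + v) / (2 * m ^ 3)) =
      (1 - Complex.I) * Complex.exp (Complex.I * m ^ 4 - (1 + Complex.I) * m ^ 2) *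
        (Complex.exp (-(1 + Complex.I) * ((v ^ 2 * m / (2 * (m + v)) : ℝ) : ℂ)) *
          Complex.exp (-1 / (2 * (2 - (1 - Complex.I) * (((m + v) / (2 * m ^ 3) : ℝ) : ℂ))))) := by
  have hσ : 0 < (m + v) / (2 * m ^ 3) := by positivity
  have hk : ((m ^ 4 : ℝ) : ℂ) = (m : ℂ) ^ 4 := by push_cast; rfl
  have hm' : (m : ℂ) ≠ 0 := Complex.ofReal_ne_zero.2 hm.ne'
  have hv' : (m : ℂ) + v ≠ 0 := by exact_mod_cast hv.ne'
  set σ : ℝ := (m + v) / (2 * m ^ 3) with hσd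
  have hI : (1 - Complex.I : ℂ) ≠ 0 := fun h => by simpa using congrArg Complex.re h
  have hσ' : (σ : ℂ) ≠ 0 := Complex.ofReal_ne_zero.2 hσ.ne'
  have h2 : (2 - (1 - Complex.I) * σ : ℂ) ≠ 0 := fun h => by
    have := congrArg Complex.im h
    simp at this
    exact hσ.ne' this
  rw [bumpRay, bumpKernel, ← Complex.exp_add, ← Complex.exp_add, mul_assoc (1 - Complex.I),
    ← Complex.exp_add]
  congr 2
  -- Partial fractions at `z = 1` isolate the singular part, whose direction `1 + i` is that of
  -- `-ikz` along the ray.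
  have e1 : (-1 / (1 - (1 - (1 - Complex.I) * (σ : ℂ)) ^ 2) : ℂ)
      = -(1 + Complex.I) / (4 * σ) + -1 / (2 * (2 - (1 - Complex.I) * σ)) := by
    have h3 : (1 - (1 - (1 - Complex.I) * (σ : ℂ)) ^ 2 : ℂ)
        = (1 - Complex.I) * σ * (2 - (1 - Complex.I) * σ) := by ring
    have h4 : (1 + Complex.I : ℂ) = 2 / (1 - Complex.I) := by
      rw [eq_div_iff hI]
      linear_combination -Complex.I_sq
    rw [h3, h4]
    field_simp
    ring
  -- The excess of `1/(4σ) + m⁴σ` over its minimum `m²`.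
  have e2 : ((v ^ 2 * m / (2 * (m + v)) : ℝ) : ℂ) = 1 / (4 * σ) + m ^ 4 * σ - m ^ 2 := by
    rw [hσd]
    push_cast
    field_simp
    ring
  rw [e1, e2, hk]
  linear_combination (m : ℂ) ^ 4 * σ * Complex.I_sq

theorem integral_bumpRay_eq {m : ℝ} (hm : 0 < m) :
    ∫ σ in (0 : ℝ)..1, bumpRay (m ^ 4) σ =
      (1 - Complex.I) / 2 * ((m ^ 3 : ℝ) : ℂ)⁻¹ *
        Complex.exp (Complex.I * m ^ 4 - (1 + Complex.I) * m ^ 2) * ∫ v, saddleIntegrand m v := by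
  have hc : (0 : ℝ) < 2 * m ^ 3 := by positivity
  rw [intervalIntegral.integral_of_le zero_le_one, ← integral_indicator measurableSet_Ioc]
  have h1 := Measure.integral_comp_mul_left ((Set.Ioc (0 : ℝ) 1).indicator (bumpRay (m ^ 4)))
    (2 * m ^ 3)⁻¹
  rw [inv_inv, abs_of_pos hc, ← integral_add_left_eq_self _ m] at h1
  have h2 : (fun v : ℝ => (Set.Ioc (0 : ℝ) 1).indicator (bumpRay (m ^ 4)) ((2 * m ^ 3)⁻¹ * (m + v)))
      = fun v => (1 - Complex.I) * Complex.exp (Complex.I * m ^ 4 - (1 + Complex.I) * m ^ 2) *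
        saddleIntegrand m v := by
    ext v
    have hs : (2 * m ^ 3)⁻¹ * (m + v) = (m + v) / (2 * m ^ 3) := by ring
    rw [hs]
    by_cases hv : 0 < m + v ∧ m + v ≤ 2 * m ^ 3
    · rw [Set.indicator_of_mem (show _ ∈ Set.Ioc (0 : ℝ) 1 from
        ⟨div_pos hv.1 hc, (div_le_one hc).2 hv.2⟩), saddleIntegrand, Set.indicator_of_mem
          (show v ∈ {v : ℝ | 0 < m + v ∧ m + v ≤ 2 * m ^ 3} from hv),
        bumpRay_saddle_scaling hm hv.1]
    · rw [Set.indicator_of_notMem (fun h => hv ⟨(div_pos_iff_of_pos_right hc).1 h.1,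
          (div_le_one hc).1 h.2⟩), saddleIntegrand, Set.indicator_of_notMem
          (show v ∉ {v : ℝ | 0 < m + v ∧ m + v ≤ 2 * m ^ 3} from hv), mul_zero]
  rw [h2, integral_const_mul, Complex.real_smul] at h1
  have hc' : ((2 * m ^ 3 : ℝ) : ℂ) ≠ 0 := Complex.ofReal_ne_zero.2 hc.ne'
  have hm' : (m : ℂ) ≠ 0 := Complex.ofReal_ne_zero.2 hm.ne'
  apply mul_left_cancel₀ hc'
  rw [← h1]
  push_cast
  field_simp

/-! ### Dominated convergence to the Gaussian -/

theorem measurable_saddleIntegrand (m : ℝ) : Measurable (saddleIntegrand m) := by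
  unfold saddleIntegrand
  refine Measurable.indicator (by fun_prop) ?_
  exact (measurableSet_lt measurable_const (measurable_const_add m)).inter
    (measurableSet_le (measurable_const_add m) measurable_const)

theorem norm_saddleIntegrand_le {m : ℝ} (hm : 1 ≤ m) (v : ℝ) :
    ‖saddleIntegrand m v‖ ≤ Real.exp (1 / 2) * Real.exp (-(1 / 2) * |v|) := by
  rw [saddleIntegrand, Set.indicator_apply]
  split_ifs with h
  · obtain ⟨h0, h1⟩ : 0 < m + v ∧ m + v ≤ 2 * m ^ 3 := h
    have hc : (0 : ℝ) < 2 * m ^ 3 := by positivity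
    have hs1 : (m + v) / (2 * m ^ 3) ≤ 1 := (div_le_one hc).2 h1
    set σ : ℝ := (m + v) / (2 * m ^ 3)
    rw [norm_mul, Complex.norm_exp, Complex.norm_exp]
    have e1 : (-(1 + Complex.I) * ((v ^ 2 * m / (2 * (m + v)) : ℝ) : ℂ)).re
        ≤ 1 / 2 + -(1 / 2) * |v| := by
      rw [Complex.re_mul_ofReal]
      -- For `m ≥ 1`, `m + v ≤ m(1 + |v|)`, so the right side is at least `v²/(2(1 + |v|))`, and `v²
      -- ≥ (|v| - 1)(|v| + 1)`.
      have h5 : (|v| - 1) / 2 ≤ v ^ 2 * m / (2 * (m + v)) := by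
        rw [div_le_div_iff₀ two_pos (by positivity), ← sq_abs v]
        have hle : m + v ≤ m * (1 + |v|) := by nlinarith [le_abs_self v, abs_nonneg v]
        rcases le_total 1 |v| with hv | hv
        · nlinarith [mul_le_mul_of_nonneg_left hle (sub_nonneg.2 hv)]
        · nlinarith [mul_nonneg (sub_nonneg.2 hv) h0.le, mul_nonneg (sq_nonneg |v|) (zero_le_one.trans hm)]
      simp
      linarith
    have e2 : (-1 / (2 * (2 - (1 - Complex.I) * (σ : ℂ)))).re ≤ 0 := by
      rw [neg_div, Complex.neg_re, one_div, Complex.inv_re]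
      refine neg_nonpos.2 (div_nonneg ?_ (Complex.normSq_nonneg _))
      simp
      linarith
    calc _ ≤ Real.exp (1 / 2 + -(1 / 2) * |v|) * 1 :=
          mul_le_mul (Real.exp_le_exp.2 e1) (Real.exp_le_one_iff.2 e2) (Real.exp_pos _).le
            (Real.exp_pos _).le
      _ = _ := by rw [mul_one, Real.exp_add]
  · rw [norm_zero]
    positivity

theorem integrable_exp_neg_mul_abs {b : ℝ} (hb : 0 < b) :
    Integrable fun v : ℝ => Real.exp (-b * |v|) := by
  rw [← integrableOn_univ, ← Set.Iic_union_Ioi (a := (0 : ℝ))]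
  refine IntegrableOn.union ?_ ?_
  · refine (integrableOn_exp_mul_Iic hb 0).congr_fun (fun v hv => ?_) measurableSet_Iic
    simp only [abs_of_nonpos (Set.mem_Iic.1 hv), mul_neg, neg_mul, neg_neg]
  · refine (exp_neg_integrableOn_Ioi 0 hb).congr_fun (fun v hv => ?_) measurableSet_Ioi
    simp only [abs_of_pos (Set.mem_Ioi.1 hv)]

/-- The Gaussian factor `∫ exp (-(1 + i) v ^ 2 / 2) dv = √(2π / (1 + i))` of the saddle point. -/
noncomputable def saddleGaussian : ℂ := ((Real.pi : ℂ) / ((1 + Complex.I) / 2)) ^ (1 / 2 : ℂ)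

theorem tendsto_saddleIntegrand (v : ℝ) :
    Tendsto (fun m => saddleIntegrand m v) atTop
      (nhds (Complex.exp (-((1 + Complex.I) / 2) * v ^ 2) * Complex.exp (-1 / 4))) := by
  have hv : Tendsto (fun m : ℝ => v / m) atTop (nhds 0) := tendsto_const_nhds.div_atTop tendsto_id
  have hσ : Tendsto (fun m : ℝ => (m + v) / (2 * m ^ 3)) atTop (nhds 0) := by
    have h1 : Tendsto (fun m : ℝ => (1 + v / m) * (2 * m ^ 2)⁻¹) atTop (nhds ((1 + 0) * 0)) :=
      (hv.const_add 1).mul (tendsto_inv_atTop_zero.comp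
        ((tendsto_pow_atTop two_ne_zero).const_mul_atTop two_pos))
    rw [mul_zero] at h1
    refine h1.congr' ?_
    filter_upwards [eventually_gt_atTop 0] with m hm
    field_simp
  have hq : Tendsto (fun m : ℝ => v ^ 2 * m / (2 * (m + v))) atTop (nhds (v ^ 2 / 2)) := by
    have h1 : Tendsto (fun m : ℝ => v ^ 2 / (2 * (1 + v / m))) atTop
        (nhds (v ^ 2 / (2 * (1 + 0)))) :=
      tendsto_const_nhds.div ((hv.const_add 1).const_mul 2) (by norm_num)
    rw [add_zero, mul_one] at h1
    refine h1.congr' ?_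
    filter_upwards [eventually_gt_atTop 0, eventually_gt_atTop (-v)] with m hm hmv
    have : m + v ≠ 0 := by linarith
    field_simp
  have hev : ∀ᶠ m : ℝ in atTop, 0 < m + v ∧ m + v ≤ 2 * m ^ 3 := by
    filter_upwards [eventually_gt_atTop 0, eventually_gt_atTop (-v),
      hσ.eventually (gt_mem_nhds one_pos)] with m hm hmv h
    refine ⟨by linarith, ?_⟩
    rw [div_lt_one (by positivity)] at h
    exact h.le
  have hlim : Tendsto (fun m : ℝ =>
      Complex.exp (-(1 + Complex.I) * ((v ^ 2 * m / (2 * (m + v)) : ℝ) : ℂ)) *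
      Complex.exp (-1 / (2 * (2 - (1 - Complex.I) * (((m + v) / (2 * m ^ 3) : ℝ) : ℂ))))) atTop
      (nhds (Complex.exp (-(1 + Complex.I) * ((v ^ 2 / 2 : ℝ) : ℂ)) *
        Complex.exp (-1 / (2 * (2 - (1 - Complex.I) * ((0 : ℝ) : ℂ)))))) := by
    refine Tendsto.mul ?_ ?_
    · exact (Complex.continuous_exp.tendsto _).comp
        (((Complex.continuous_ofReal.tendsto _).comp hq).const_mul _)
    · refine (Complex.continuous_exp.tendsto _).comp (tendsto_const_nhds.div ?_ (by simp))
      exact ((((Complex.continuous_ofReal.tendsto _).comp hσ).const_mul _).const_sub _).const_mul _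
  have e : Complex.exp (-((1 + Complex.I) / 2) * v ^ 2) * Complex.exp (-1 / 4)
      = Complex.exp (-(1 + Complex.I) * ((v ^ 2 / 2 : ℝ) : ℂ)) *
        Complex.exp (-1 / (2 * (2 - (1 - Complex.I) * ((0 : ℝ) : ℂ)))) := by
    congr 2
    · push_cast; ring
    · norm_num
  rw [e]
  refine hlim.congr' ?_
  filter_upwards [hev] with m hm
  rw [saddleIntegrand, Set.indicator_of_mem
    (show v ∈ {v : ℝ | 0 < m + v ∧ m + v ≤ 2 * m ^ 3} from hm)]

theorem tendsto_integral_saddleIntegrand :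
    Tendsto (fun m => ∫ v, saddleIntegrand m v) atTop
      (nhds (saddleGaussian * Complex.exp (-1 / 4))) := by
  rw [saddleGaussian, ← integral_gaussian_complex (by simp), ← integral_mul_const]
  refine tendsto_integral_filter_of_dominated_convergence
    (fun v => Real.exp (1 / 2) * Real.exp (-(1 / 2) * |v|))
    (Eventually.of_forall fun m => (measurable_saddleIntegrand m).aestronglyMeasurable)
    ?_ ((integrable_exp_neg_mul_abs one_half_pos).const_mul _)
    (Eventually.of_forall tendsto_saddleIntegrand)
  filter_upwards [eventually_ge_atTop 1] with m hm
  exact Eventually.of_forall (norm_saddleIntegrand_le hm)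

/-! ### Matching the branches of the square roots -/

theorem Complex.sqrt_eq_of_sq_eq {z w : ℂ} (h : z ^ 2 = w) (hz : 0 < z.re) :
    Complex.sqrt w = z := by
  rw [← h, Complex.sqrt, Complex.sq_cpow_two_inv hz]

theorem saddleGaussian_sq : saddleGaussian ^ 2 = Real.pi * (1 - Complex.I) := by
  have h : saddleGaussian = ((Real.pi : ℂ) / ((1 + Complex.I) / 2)) ^ (((2 : ℕ) : ℂ)⁻¹) := by
    rw [saddleGaussian]; norm_num
  have hI : (1 + Complex.I : ℂ) ≠ 0 := fun h => by simpa using congrArg Complex.re h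
  rw [h, Complex.cpow_nat_inv_pow _ two_ne_zero]
  field_simp
  linear_combination Complex.I_sq

/-- The sum is the real part of `(1 - i)` times the Gaussian factor; its sign identifies the
principal root in `saddleTerm_pow_four`. It is positive because the square of the factor has real
part `π > 0`, which forces `|im| < re`. -/
theorem re_saddleGaussian_add_im_pos : 0 < saddleGaussian.re + saddleGaussian.im := by
  have h0 : 0 ≤ saddleGaussian.re := by
    rw [saddleGaussian, one_div, Complex.cpow_inv_two_re]
    exact Real.sqrt_nonneg _
  have h1 := congrArg Complex.re saddleGaussian_sq
  rw [Complex.re_ofReal_mul, sq, Complex.mul_re] at h1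
  simp at h1
  have h2 : |saddleGaussian.im| < saddleGaussian.re :=
    abs_lt_of_sq_lt_sq (by nlinarith [Real.pi_pos]) h0
  linarith [neg_abs_le saddleGaussian.im]

theorem norm_saddleGaussian_sq : ‖saddleGaussian‖ ^ 2 = Real.pi * Real.sqrt 2 := by
  rw [← norm_pow, saddleGaussian_sq, norm_mul, Complex.norm_real, Real.norm_of_nonneg Real.pi_pos.le]
  congr 1
  rw [Complex.norm_def, Complex.normSq_apply]
  norm_num

theorem saddleTerm_pow_four {m : ℝ} (hm : 0 < m) :
    saddleTerm (m ^ 4) = (1 - Complex.I) / 2 * ((m ^ 3 : ℝ) : ℂ)⁻¹ *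
      Complex.exp (Complex.I * m ^ 4 - (1 + Complex.I) * m ^ 2) *
        (saddleGaussian * Complex.exp (-1 / 4)) := by
  have hI : (1 + Complex.I : ℂ) ≠ 0 := fun h => by simpa using congrArg Complex.re h
  have hm' : (m : ℂ) ≠ 0 := Complex.ofReal_ne_zero.2 hm.ne'
  have h1 : Complex.sqrt (2 * Complex.I) = 1 + Complex.I :=
    Complex.sqrt_eq_of_sq_eq (by linear_combination Complex.I_sq) (by simp)
  have h2 : Complex.sqrt (2 * Complex.I * ((m ^ 4 : ℝ) : ℂ)) = (1 + Complex.I) * m ^ 2 := by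
    refine Complex.sqrt_eq_of_sq_eq ?_ ?_
    · push_cast
      linear_combination (m : ℂ) ^ 4 * Complex.I_sq
    · rw [← Complex.ofReal_pow, Complex.re_mul_ofReal]
      simp only [Complex.add_re, Complex.one_re, Complex.I_re, add_zero, one_mul]
      exact pow_pos hm 2
  have h3 : (m ^ 4 : ℝ) ^ (3 / 2 : ℝ) = m ^ 6 := by
    rw [← Real.rpow_natCast m 4, ← Real.rpow_mul hm.le, ← Real.rpow_natCast m 6]
    norm_num
  have h4 : Complex.sqrt (-Complex.I * (Real.pi : ℂ) / ((1 + Complex.I) * ((m ^ 6 : ℝ) : ℂ)))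
      = (1 - Complex.I) / 2 * ((m ^ 3 : ℝ) : ℂ)⁻¹ * saddleGaussian := by
    refine Complex.sqrt_eq_of_sq_eq ?_ ?_
    · rw [mul_pow, saddleGaussian_sq]
      push_cast
      field_simp
      linear_combination (1 + 2 * Complex.I - Complex.I ^ 2) * Complex.I_sq
    · rw [← Complex.ofReal_inv, mul_right_comm, Complex.re_mul_ofReal]
      refine mul_pos ?_ (by positivity)
      have := re_saddleGaussian_add_im_pos
      simp [Complex.mul_re]
      linarith
  rw [saddleTerm, h1, h2, h3, h4]
  have h5 : (Complex.I * ((m ^ 4 : ℝ) : ℂ) - 1 / 4 - (1 + Complex.I) * m ^ 2 : ℂ)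
      = (Complex.I * m ^ 4 - (1 + Complex.I) * m ^ 2) + -1 / 4 := by
    push_cast; ring
  rw [h5, Complex.exp_add]
  ring

theorem norm_exp_saddle (m : ℝ) :
    ‖Complex.exp (Complex.I * m ^ 4 - (1 + Complex.I) * m ^ 2)‖ = Real.exp (-m ^ 2) := by
  rw [Complex.norm_exp, ← Complex.ofReal_pow, ← Complex.ofReal_pow, Complex.sub_re,
    Complex.re_mul_ofReal, Complex.re_mul_ofReal]
  simp

theorem norm_one_sub_I_div_two_le : ‖((1 - Complex.I) / 2 : ℂ)‖ ≤ 1 := by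
  have := norm_sub_le (1 : ℂ) Complex.I
  rw [norm_div]
  norm_num at this ⊢
  linarith

/-! ### The error estimate, in `m` and then in `k` -/

theorem isLittleO_bumpFourier_pow_four :
    (fun m : ℝ => bumpFourier (m ^ 4) - ((2 * (saddleTerm (m ^ 4)).re : ℝ) : ℂ))
      =o[atTop] fun m : ℝ => (m ^ 3)⁻¹ * Real.exp (-m ^ 2) := by
  have hJ : Tendsto (fun m : ℝ => 2 * ‖(∫ v, saddleIntegrand m v) -
      saddleGaussian * Complex.exp (-1 / 4)‖) atTop (nhds 0) := by
    simpa using (tendsto_iff_norm_sub_tendsto_zero.1 tendsto_integral_saddleIntegrand).const_mul 2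
  rw [isLittleO_iff]
  intro c hc
  filter_upwards [eventually_gt_atTop 0, hJ.eventually (gt_mem_nhds hc)] with m hm h
  rw [bumpFourier_eq (by positivity), integral_bumpRay_eq hm, saddleTerm_pow_four hm,
    ← Complex.ofReal_sub, ← mul_sub, ← Complex.sub_re, ← mul_sub, Complex.norm_real, norm_mul,
    Real.norm_of_nonneg (by positivity : 0 ≤ (m ^ 3)⁻¹ * Real.exp (-m ^ 2)), Real.norm_two,
    Real.norm_eq_abs]
  set D := (∫ v, saddleIntegrand m v) - saddleGaussian * Complex.exp (-1 / 4)
  calc _ ≤ 2 * ‖(1 - Complex.I) / 2 * ((m ^ 3 : ℝ) : ℂ)⁻¹ *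
        Complex.exp (Complex.I * m ^ 4 - (1 + Complex.I) * m ^ 2) * D‖ := by
        gcongr
        exact Complex.abs_re_le_norm _
    _ = ‖((1 - Complex.I) / 2 : ℂ)‖ * ((2 * ‖D‖) * ((m ^ 3)⁻¹ * Real.exp (-m ^ 2))) := by
        rw [norm_mul, norm_mul, norm_mul, norm_exp_saddle, norm_inv, Complex.norm_real,
          Real.norm_of_nonneg (by positivity : 0 ≤ m ^ 3)]
        ring
    _ ≤ 1 * (c * ((m ^ 3)⁻¹ * Real.exp (-m ^ 2))) := by
        gcongr
        exact norm_one_sub_I_div_two_le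
    _ = _ := one_mul _

theorem scale_pow_four {m : ℝ} (hm : 0 < m) :
    (m ^ 4 : ℝ) ^ (-(3 / 4) : ℝ) * Real.exp (-Real.sqrt (m ^ 4)) =
      (m ^ 3)⁻¹ * Real.exp (-m ^ 2) := by
  congr 2
  · rw [← Real.rpow_natCast m 4, ← Real.rpow_mul hm.le, ← Real.rpow_natCast m 3,
      ← Real.rpow_neg hm.le]
    norm_num
  · rw [show m ^ 4 = (m ^ 2) ^ 2 by ring, Real.sqrt_sq (by positivity)]

/-- Equality of filters, not mere convergence, is what carries asymptotics and limsups from `m` back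
to `k`. -/
theorem map_pow_four_atTop : map (fun m : ℝ => m ^ 4) atTop = atTop := by
  refine le_antisymm (tendsto_pow_atTop (by norm_num)) ?_
  have h : Tendsto (fun k : ℝ => k ^ (1 / 4 : ℝ)) atTop atTop := tendsto_rpow_atTop (by norm_num)
  calc (atTop : Filter ℝ) = map ((fun m : ℝ => m ^ 4) ∘ fun k : ℝ => k ^ (1 / 4 : ℝ)) atTop := by
        rw [Filter.map_congr (m₂ := id), Filter.map_id]
        filter_upwards [eventually_ge_atTop 0] with k hk
        rw [Function.comp_apply, ← Real.rpow_natCast, ← Real.rpow_mul hk]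
        norm_num
    _ = map (fun m : ℝ => m ^ 4) (map (fun k : ℝ => k ^ (1 / 4 : ℝ)) atTop) := map_map.symm
    _ ≤ _ := map_mono h

theorem isLittleO_bumpFourier :
    (fun k : ℝ => bumpFourier k - ((2 * (saddleTerm k).re : ℝ) : ℂ))
      =o[atTop] fun k : ℝ => k ^ (-(3 / 4) : ℝ) * Real.exp (-Real.sqrt k) := by
  rw [← map_pow_four_atTop, isLittleO_map]
  refine isLittleO_bumpFourier_pow_four.congr' (Eventually.of_forall fun _ => rfl) ?_
  filter_upwards [eventually_gt_atTop 0] with m hm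
  exact (scale_pow_four hm).symm

/-! ### The sharp constant -/

/-- The modulus of the saddle term relative to `k ^ (-3/4) * exp (-√k)`. -/
theorem exists_saddleTerm_eq_norm_mul_exp : ∃ θ : ℝ, ∀ m : ℝ, 0 < m →
    saddleTerm (m ^ 4) = ((Real.sqrt (Real.pi / Real.sqrt 2) * Real.exp (-(1 / 4)) *
      ((m ^ 3)⁻¹ * Real.exp (-m ^ 2)) : ℝ) : ℂ) *
        Complex.exp (((θ + (m ^ 4 - m ^ 2) : ℝ) : ℂ) * Complex.I) := by
  set c : ℂ := (1 - Complex.I) / 2 * saddleGaussian with hc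
  have hn : ‖c‖ = Real.sqrt (Real.pi / Real.sqrt 2) := by
    rw [eq_comm, Real.sqrt_eq_iff_eq_sq (by positivity) (norm_nonneg _), hc, norm_mul, mul_pow,
      norm_saddleGaussian_sq, ← norm_pow]
    have : ((1 - Complex.I) / 2 : ℂ) ^ 2 = -Complex.I / 2 := by
      linear_combination Complex.I_sq / 4
    rw [this, norm_div, norm_neg, Complex.norm_I]
    have h2 : Real.sqrt 2 ≠ 0 := by positivity
    have h3 : Real.sqrt 2 ^ 2 = 2 := Real.sq_sqrt zero_le_two
    rw [div_eq_iff h2, Complex.norm_ofNat]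
    linear_combination -(Real.pi / 2) * h3
  refine ⟨c.arg, fun m hm => ?_⟩
  rw [saddleTerm_pow_four hm, ← hn]
  have h1 : Complex.exp (Complex.I * m ^ 4 - (1 + Complex.I) * m ^ 2)
      = ((Real.exp (-m ^ 2) : ℝ) : ℂ) * Complex.exp (((m ^ 4 - m ^ 2 : ℝ) : ℂ) * Complex.I) := by
    rw [Complex.ofReal_exp, ← Complex.exp_add]
    congr 1
    push_cast
    ring
  have h2 : Complex.exp (-1 / 4) = ((Real.exp (-(1 / 4)) : ℝ) : ℂ) := by
    push_cast
    norm_num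
  have h3 := Complex.norm_mul_exp_arg_mul_I c
  rw [h1, h2, Complex.ofReal_add, add_mul, Complex.exp_add]
  push_cast
  rw [show (1 - Complex.I) / 2 * ((m : ℂ) ^ 3)⁻¹ *
    (Complex.exp (-(m : ℂ) ^ 2) * Complex.exp (((m : ℂ) ^ 4 - m ^ 2) * Complex.I)) *
    (saddleGaussian * Complex.exp (-(1 / 4))) = c * (((m : ℂ) ^ 3)⁻¹ *
    (Complex.exp (-(m : ℂ) ^ 2) * Complex.exp (((m : ℂ) ^ 4 - m ^ 2) * Complex.I)) *
    Complex.exp (-(1 / 4))) by rw [hc]; ring]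
  conv_lhs => rw [← h3]
  ring

theorem limsup_eq_of_sub_cos_tendsto_zero {r φ : ℝ → ℝ} {C : ℝ} (hC : 0 ≤ C)
    (hφ : Continuous φ) (hφ' : Tendsto φ atTop atTop)
    (h : Tendsto (fun x => r x - C * |Real.cos (φ x)|) atTop (nhds 0)) :
    limsup r atTop = C := by
  have hup : ∀ ε : ℝ, 0 < ε → ∀ᶠ x in atTop, r x ≤ C + ε := fun ε hε => by
    filter_upwards [h.eventually (gt_mem_nhds hε)] with x hx
    linarith [mul_le_of_le_one_right hC (Real.abs_cos_le_one (φ x))]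
  have hlow : ∀ ε : ℝ, 0 < ε → ∃ᶠ x in atTop, C - ε ≤ r x := fun ε hε => by
    -- Beyond any point, `φ` takes some value `2πn` by the intermediate value theorem.
    have hf : ∃ᶠ x in atTop, Real.cos (φ x) = 1 := by
      rw [frequently_atTop]
      intro a
      obtain ⟨n, hn⟩ := exists_nat_gt (φ a / (2 * Real.pi))
      have hn' : φ a ≤ n * (2 * Real.pi) := ((div_lt_iff₀ (by positivity)).1 hn).le
      obtain ⟨b, hb, hab⟩ :=
        ((hφ'.eventually_ge_atTop (n * (2 * Real.pi))).and (eventually_ge_atTop a)).exists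
      obtain ⟨x, hx, hxe⟩ := intermediate_value_Icc hab hφ.continuousOn ⟨hn', hb⟩
      exact ⟨x, hx.1, by rw [hxe, Real.cos_nat_mul_two_pi]⟩
    refine (hf.and_eventually (h.eventually (lt_mem_nhds (neg_lt_zero.2 hε)))).mono ?_
    rintro x ⟨hx, hx'⟩
    rw [hx, abs_one, mul_one] at hx'
    linarith
  have hbdd : IsBoundedUnder (· ≤ ·) atTop r := ⟨C + 1, eventually_map.2 (hup 1 one_pos)⟩
  have hcobdd : IsCoboundedUnder (· ≤ ·) atTop r :=
    IsCoboundedUnder.of_frequently_ge (hlow 1 one_pos)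
  refine le_antisymm (le_of_forall_pos_le_add fun ε hε => limsup_le_of_le hcobdd (hup ε hε))
    (le_of_forall_pos_le_add fun ε hε => ?_)
  linarith [le_limsup_of_frequently_le (hlow ε hε) hbdd]

theorem isBigO_saddleTerm_re :
    (fun k : ℝ => ((2 * (saddleTerm k).re : ℝ) : ℂ))
      =O[atTop] fun k : ℝ => k ^ (-(3 / 4) : ℝ) * Real.exp (-Real.sqrt k) := by
  rw [← map_pow_four_atTop, isBigO_map]
  obtain ⟨θ, hθ⟩ := exists_saddleTerm_eq_norm_mul_exp
  refine IsBigO.of_bound (2 * (Real.sqrt (Real.pi / Real.sqrt 2) * Real.exp (-(1 / 4)))) ?_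
  filter_upwards [eventually_gt_atTop 0] with m hm
  have hs : 0 < (m ^ 3)⁻¹ * Real.exp (-m ^ 2) := by positivity
  simp only [Function.comp_apply]
  rw [scale_pow_four hm, Complex.norm_real, norm_mul, Real.norm_two, Real.norm_of_nonneg hs.le,
    mul_assoc]
  refine mul_le_mul_of_nonneg_left ((Complex.abs_re_le_norm _).trans ?_) zero_le_two
  rw [hθ m hm, norm_mul, Complex.norm_exp_ofReal_mul_I, mul_one, Complex.norm_real,
    Real.norm_of_nonneg (by positivity)]

theorem limsup_norm_bumpFourier :
    limsup (fun k : ℝ => ‖bumpFourier k‖ / (k ^ (-(3 / 4) : ℝ) * Real.exp (-Real.sqrt k))) atTop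
      = 2 * Real.sqrt (Real.pi / Real.sqrt 2) * Real.exp (-(1 / 4)) := by
  obtain ⟨θ, hθ⟩ := exists_saddleTerm_eq_norm_mul_exp
  rw [← map_pow_four_atTop, ← limsup_comp]
  refine limsup_eq_of_sub_cos_tendsto_zero (φ := fun m => θ + (m ^ 4 - m ^ 2)) (by positivity)
    (by fun_prop) ?_ ?_
  · refine tendsto_atTop_add_const_left _ _ ?_
    refine tendsto_atTop_mono' _ ?_ (tendsto_pow_atTop (α := ℝ) two_ne_zero)
    filter_upwards [eventually_ge_atTop 2] with m hm
    nlinarith [sq_nonneg m, mul_nonneg (sq_nonneg m) (sub_nonneg.2 (by nlinarith : (2 : ℝ) ≤ m ^ 2))]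
  · refine squeeze_zero_norm' ?_ isLittleO_bumpFourier_pow_four.norm_norm.tendsto_div_nhds_zero
    filter_upwards [eventually_gt_atTop 0] with m hm
    have hs : 0 < (m ^ 3)⁻¹ * Real.exp (-m ^ 2) := by positivity
    have hre : ‖((2 * (saddleTerm (m ^ 4)).re : ℝ) : ℂ)‖ =
        2 * Real.sqrt (Real.pi / Real.sqrt 2) * Real.exp (-(1 / 4)) *
          |Real.cos (θ + (m ^ 4 - m ^ 2))| * ((m ^ 3)⁻¹ * Real.exp (-m ^ 2)) := by
      rw [hθ m hm, Complex.re_ofReal_mul, Complex.exp_ofReal_mul_I_re, Complex.norm_real,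
        Real.norm_eq_abs, abs_mul, abs_mul, abs_two, abs_of_nonneg (a := _ * _) (by positivity)]
      ring
    simp only [Function.comp_apply]
    rw [scale_pow_four hm, Real.norm_of_nonneg hs.le, ← mul_div_cancel_right₀
      (2 * Real.sqrt (Real.pi / Real.sqrt 2) * Real.exp (-(1 / 4)) *
          |Real.cos (θ + (m ^ 4 - m ^ 2))|) hs.ne', ← hre, ← sub_div, norm_div,
      Real.norm_of_nonneg hs.le]
    gcongr
    exact abs_norm_sub_norm_le _ _

theorem mainTheorem1 :
    ((fun k : ℝ => bumpFourier k - ((2 * (saddleTerm k).re : ℝ) : ℂ))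
      =o[atTop] fun k : ℝ => k ^ (-(3 / 4) : ℝ) * Real.exp (-Real.sqrt k)) ∧
    (bumpFourier =O[atTop] fun k : ℝ => k ^ (-(3 / 4) : ℝ) * Real.exp (-Real.sqrt k)) ∧
    limsup (fun k : ℝ => ‖bumpFourier k‖ / (k ^ (-(3 / 4) : ℝ) * Real.exp (-Real.sqrt k))) atTop
      = 2 * Real.sqrt (Real.pi / Real.sqrt 2) * Real.exp (-(1 / 4)) := by
  refine ⟨isLittleO_bumpFourier, ?_, limsup_norm_bumpFourier⟩
  exact (isLittleO_bumpFourier.isBigO.add isBigO_saddleTerm_re).congr_left fun k =>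
    sub_add_cancel _ _
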